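/- A Banach sequence lattice $Y$ is an order ideal of the space $\mathbb{R}^{\mathbb{N}}$ of real sequences that contains every canonical sequence $e_k$ and is complete for a norm $\|\cdot\|_Y$ with $\|f\|_Y\le\|g\|_Y$ whenever $|f|\le|g|$, $g\in Y$. Write $\|(t_1,\dots,t_n)\|_{\mathbb{R}^n,Y}:=\|(t_1,\dots,t_n,0,0,\dots)\|_Y$. For a real Banach lattice $X$ and $x=(x_1,\dots,x_n)\in X^n$, let $\tau_{n,x}$ be Krivine's functional calculus: the unique linear map, from the space $\mathcal{H}_n$ of continuous $h:\mathbb{R}^n\to\mathbb{R}$ with $h(\lambda t)=\lambda h(t)$ for all $\lambda\ge 0$, to $X$, that sends the $j$-th coordinate projection to $x_j$ for each $j$ and satisfies $\tau_{n,x}(h_1\vee h_2)=\tau_{n,x}(h_1)\vee\tau_{n,x}(h_2)$. Put $$\|(x_1,\dots,x_n)\|_{X^n,Y,\tau}:=\bigl\|\tau_{n,x}\bigl(\|\cdot\|_{\mathbb{R}^n,Y}\bigr)\bigr\|_X .$$ **Theorem.** Let $Y$ be a Banach sequence lattice and let $X,W$ be real Banach lattices. Let $\Lambda_Y(X,W)$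 be the set of all linear maps $T:X\to W$ (not assumed continuous) for which there is a constant $C>0$ with $$\|(Tx_1,\dots,Tx_n)\|_{W^n,Y,\tau}\le C\,\|(x_1,\dots,x_n)\|_{X^n,Y,\tau}\qquad\text{for all } n\in\mathbb{N},\ x_1,\dots,x_n\in X .$$ For $T\in\Lambda_Y(X,W)$ let $\|T\|_{\Lambda_Y}$ be the infimum of the constants $C\ge 0$ satisfying this inequality. Then $\Lambda_Y(X,W)$ is a linear space of operators; the infimum is attained, so $\|T\|_{\Lambda_Y}$ is the smallest such constant $C\ge 0$; $\|\cdot\|_{\Lambda_Y}$ is a norm on $\Lambda_Y(X,W)$; and $\Lambda_Y(X,W)$ with this norm is a Banach space. Moreover every $T\in\Lambda_Y(X,W)$ is continuous, the inclusion $\Lambda_Y(X,W)\subset\mathcal{L}(X,W)$ is continuous, and $\|T\|\le\|T\|_{\Lambda_Y}$. -/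

import Mathlib

open Filter Topology

/-- A Banach sequence lattice: an order ideal `carrier` of the space of all real sequences (that is,
of `L⁰` of the counting measure on `ℕ`) which contains every canonical sequence `e_k`, equipped with
a complete norm `nrm` that is a lattice norm: `|f| ≤ |g|` and `g ∈ Y` give `f ∈ Y` and
`‖f‖_Y ≤ ‖g‖_Y`. -/
structure BanachSequenceLattice where
  carrier : Submodule ℝ (ℕ → ℝ)
  nrm : Seminorm ℝ carrier
  eq_zero_of_nrm_eq_zero : ∀ f : carrier, nrm f = 0 → f = 0
  solid : ∀ (f : ℕ → ℝ) (g : carrier), (∀ k, |f k| ≤ |(g : ℕ → ℝ) k|) →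
    ∃ hf : f ∈ carrier, nrm ⟨f, hf⟩ ≤ nrm g
  complete : ∀ u : ℕ → carrier,
    (∀ ε : ℝ, 0 < ε → ∃ N, ∀ m, N ≤ m → ∀ n, N ≤ n → nrm (u m - u n) < ε) →
    ∃ f : carrier, Tendsto (fun m => nrm (u m - f)) atTop (𝓝 0)
  single_mem : ∀ k : ℕ, (Pi.single k 1 : ℕ → ℝ) ∈ carrier

namespace BanachSequenceLattice

/-- A finite sequence extended by zero belongs to `Y`. -/
theorem extend_mem (Y : BanachSequenceLattice) (n : ℕ) (t : Fin n → ℝ) :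
    Function.ExtendByZero.linearMap ℝ (Fin.val : Fin n → ℕ) t ∈ Y.carrier := by
  have ht : t = ∑ i, t i • (Pi.single i 1 : Fin n → ℝ) := by
    ext j
    simp [Finset.sum_apply, Pi.single_apply]
  rw [ht, map_sum]
  refine Submodule.sum_mem _ fun i _ => ?_
  rw [map_smul]
  refine Submodule.smul_mem _ _ ?_
  convert Y.single_mem i
  ext k
  simp only [Function.ExtendByZero.linearMap_apply]
  by_cases hk : ∃ j : Fin n, j.val = k
  · obtain ⟨j, rfl⟩ := hk
    rw [Fin.val_injective.extend_apply]
    simp [Pi.single_apply, Fin.ext_iff]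
  · rw [Function.extend_apply' _ _ _ hk]
    have : k ≠ (i : ℕ) := fun h => hk ⟨i, h.symm⟩
    simp [this]

/-- The inclusion `ℝⁿ → Y`, `(t₁, …, tₙ) ↦ (t₁, …, tₙ, 0, 0, …)`. -/
noncomputable def incl (Y : BanachSequenceLattice) (n : ℕ) : (Fin n → ℝ) →ₗ[ℝ] Y.carrier :=
  (Function.ExtendByZero.linearMap ℝ (Fin.val : Fin n → ℕ)).codRestrict Y.carrier (Y.extend_mem n)

/-- The norm `‖·‖_{ℝⁿ,Y}`, the restriction of the norm of `Y` to `ℝⁿ`. -/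
noncomputable def finNorm (Y : BanachSequenceLattice) (n : ℕ) : Seminorm ℝ (Fin n → ℝ) :=
  Y.nrm.comp (Y.incl n)

theorem continuous_finNorm (Y : BanachSequenceLattice) (n : ℕ) : Continuous (Y.finNorm n) := by
  have h : ConvexOn ℝ Set.univ (Y.finNorm n) := (Y.finNorm n).convexOn
  exact continuousOn_univ.1 (h.continuousOn isOpen_univ)

end BanachSequenceLattice

/-- The space `ℋₙ` of continuous functions `h : ℝⁿ → ℝ` with `h (c t) = c h(t)` for `c ≥ 0`. -/
def HomogFun (n : ℕ) : Submodule ℝ C(Fin n → ℝ, ℝ) where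
  carrier := {h | ∀ c : ℝ, 0 ≤ c → ∀ t, h (c • t) = c * h t}
  add_mem' := by
    intro a b ha hb c hc t
    simp only [ContinuousMap.add_apply, ha c hc t, hb c hc t]
    ring
  zero_mem' := by
    intro c _ t
    simp
  smul_mem' := by
    intro r a ha c hc t
    simp only [ContinuousMap.smul_apply, smul_eq_mul, ha c hc t]
    ring

namespace HomogFun

/-- The coordinate projection `π_{n,j}` as an element of `ℋₙ`. -/
def proj {n : ℕ} (j : Fin n) : HomogFun n :=
  ⟨⟨fun t => t j, continuous_apply j⟩, fun _ _ _ => rfl⟩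

/-- The pointwise maximum of two elements of `ℋₙ`. -/
def max {n : ℕ} (h₁ h₂ : HomogFun n) : HomogFun n :=
  ⟨(h₁ : C(Fin n → ℝ, ℝ)) ⊔ (h₂ : C(Fin n → ℝ, ℝ)), by
    intro c hc t
    simp only [ContinuousMap.sup_apply, h₁.2 c hc t, h₂.2 c hc t, mul_max_of_nonneg _ _ hc]⟩

/-- The norm `‖·‖_{ℝⁿ,Y}` as an element of `ℋₙ`. -/
noncomputable def ofNorm (Y : BanachSequenceLattice) (n : ℕ) : HomogFun n :=
  ⟨⟨Y.finNorm n, Y.continuous_finNorm n⟩, by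
    intro c hc t
    simp [map_smul_eq_mul, abs_of_nonneg hc]⟩

end HomogFun

section Krivine

variable {X : Type*} [NormedAddCommGroup X] [NormedSpace ℝ X] [Lattice X]

/-- The properties that characterize the functional calculus `τ_{n,x}` at `x ∈ Xⁿ`: it is a linear
map `ℋₙ → X` that sends the `j`-th projection to `xⱼ` and preserves finite suprema. -/
structure IsKrivineCalculus {n : ℕ} (x : Fin n → X) (τ : HomogFun n →ₗ[ℝ] X) : Prop where
  map_proj : ∀ j, τ (HomogFun.proj j) = x j
  map_max : ∀ h₁ h₂, τ (HomogFun.max h₁ h₂) = τ h₁ ⊔ τ h₂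

open Classical in
/-- Krivine's functional calculus `τ_{n,x}` at `x ∈ Xⁿ`: the linear map with the properties
`IsKrivineCalculus x`, of which there is exactly one when `X` is a Banach lattice. -/
noncomputable def krivine {n : ℕ} (x : Fin n → X) : HomogFun n →ₗ[ℝ] X :=
  if h : ∃ τ, IsKrivineCalculus x τ then h.choose else 0

/-- `‖(x₁, …, xₙ)‖_{Xⁿ,Y,τ} = ‖τ_{n,x}(‖·‖_{ℝⁿ,Y})‖_X`. -/
noncomputable def tauNorm (Y : BanachSequenceLattice) {n : ℕ} (x : Fin n → X) : ℝ :=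
  ‖krivine x (HomogFun.ofNorm Y n)‖

end Krivine

section Regular

variable {X W : Type*} [NormedAddCommGroup X] [NormedSpace ℝ X] [Lattice X]
  [NormedAddCommGroup W] [NormedSpace ℝ W] [Lattice W]

/-- The inequality `‖(Tx₁, …, Txₙ)‖_{Wⁿ,Y,τ} ≤ C ‖(x₁, …, xₙ)‖_{Xⁿ,Y,τ}` for all `n` and
all `x₁, …, xₙ`. -/
def YRegularBound (Y : BanachSequenceLattice) (T : X →ₗ[ℝ] W) (C : ℝ) : Prop :=
  ∀ (n : ℕ) (x : Fin n → X), tauNorm Y (fun i => T (x i)) ≤ C * tauNorm Y x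

/-- The linear map `T` (not assumed to be continuous) is `Y`-regular. -/
def IsYRegular (Y : BanachSequenceLattice) (T : X →ₗ[ℝ] W) : Prop :=
  ∃ C : ℝ, 0 < C ∧ YRegularBound Y T C

/-- The best constant `‖T‖_{Λ_Y}`. -/
noncomputable def yRegularNorm (Y : BanachSequenceLattice) (T : X →ₗ[ℝ] W) : ℝ :=
  sInf {C : ℝ | 0 ≤ C ∧ YRegularBound Y T C}

end Regular

/-! Everything rests on the existence and uniqueness of Krivine's calculus. Elements of `HomogFun n`
are determined on the unit sphere. In `C(maxSphere n, ℝ) × X`, take the sublattice generated by the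
pairs (functional `a`, `∑ i, a i • x i`). If `a` lies below a finite maximum of functionals on the
sphere, Hahn–Banach puts it in their convex hull, so the same inequality holds in `X`
(`snd_le_snd_of_mem_supClosure`). The sublattice is therefore the graph of a positive map, bounded
for the sup norm and densely defined by Stone–Weierstrass; its extension is the calculus. Uniqueness
follows from the same density, since every calculus is automatically bounded.

Uniqueness yields the change of variables `krivine_compLinear`, through which pointwise facts about
the norm of `Y` become facts about `tauNorm`: it is a continuous seminorm on `Xⁿ`, and for `n = 1` a
positive multiple of the norm. Hence regular bounds dominate the operator norm and survive pointwise
limits, which gives completeness. -/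

section VectorLattice

/-! ### Sublattices generated by a linear subspace -/

variable {V : Type*} [AddCommGroup V] [Module ℝ V] [Lattice V]

theorem smul_sup_of_nonneg [PosSMulMono ℝ V] {c : ℝ} (hc : 0 ≤ c) (a b : V) :
    c • (a ⊔ b) = c • a ⊔ c • b := by
  rcases hc.eq_or_lt with rfl | hc'
  · simp
  refine le_antisymm ?_ (sup_le (smul_le_smul_of_nonneg_left le_sup_left hc)
    (smul_le_smul_of_nonneg_left le_sup_right hc))
  have h : a ⊔ b ≤ c⁻¹ • (c • a ⊔ c • b) := sup_le
    (by simpa [smul_smul, hc'.ne'] using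
      smul_le_smul_of_nonneg_left (le_sup_left : c • a ≤ c • a ⊔ c • b) (inv_nonneg.2 hc))
    (by simpa [smul_smul, hc'.ne'] using
      smul_le_smul_of_nonneg_left (le_sup_right : c • b ≤ c • a ⊔ c • b) (inv_nonneg.2 hc))
  simpa [smul_smul, hc'.ne'] using smul_le_smul_of_nonneg_left h hc

theorem Submodule.add_mem_supClosure [IsOrderedAddMonoid V] (E : Submodule ℝ V) {u v : V}
    (hu : u ∈ supClosure (E : Set V)) (hv : v ∈ supClosure (E : Set V)) :
    u + v ∈ supClosure (E : Set V) := by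
  refine supClosure_min (t := {u | u + v ∈ supClosure (E : Set V)}) (fun a ha => ?_) ?_ hu
  · refine supClosure_min (t := {v | a + v ∈ supClosure (E : Set V)})
      (fun b hb => subset_supClosure (E.add_mem ha hb)) ?_ hv
    intro b hb c hc
    simpa only [Set.mem_ofPred_eq, add_sup] using supClosed_supClosure hb hc
  · intro b hb c hc
    simpa only [Set.mem_ofPred_eq, sup_add] using supClosed_supClosure hb hc

theorem Submodule.smul_mem_supClosure [PosSMulMono ℝ V] (E : Submodule ℝ V) {c : ℝ} (hc : 0 ≤ c)
    {u : V} (hu : u ∈ supClosure (E : Set V)) : c • u ∈ supClosure (E : Set V) := by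
  refine supClosure_min (t := {u | c • u ∈ supClosure (E : Set V)})
    (fun a ha => subset_supClosure (E.smul_mem c ha)) ?_ hu
  intro a ha b hb
  simpa only [Set.mem_ofPred_eq, smul_sup_of_nonneg hc] using supClosed_supClosure ha hb

theorem Submodule.inf_mem_of_sup_mem [IsOrderedAddMonoid V] {L : Submodule ℝ V} (hL : SupClosed (L : Set V)) {u v : V}
    (hu : u ∈ L) (hv : v ∈ L) : u ⊓ v ∈ L := by
  have h : u ⊓ v = -(-u ⊔ -v) := by simp only [_root_.neg_sup, neg_neg]
  rw [h]
  exact L.neg_mem (hL (L.neg_mem hu) (L.neg_mem hv))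

variable [IsOrderedAddMonoid V] [PosSMulMono ℝ V]

/-- The vector sublattice generated by a linear subspace `E`: the differences of finite suprema of
elements of `E`. -/
def Submodule.latticeSpan (E : Submodule ℝ V) : Submodule ℝ V where
  carrier := {v | ∃ p ∈ supClosure (E : Set V), ∃ q ∈ supClosure (E : Set V), v = p - q}
  zero_mem' := ⟨0, subset_supClosure E.zero_mem, 0, subset_supClosure E.zero_mem, by simp⟩
  add_mem' := by
    rintro _ _ ⟨p, hp, q, hq, rfl⟩ ⟨p', hp', q', hq', rfl⟩
    exact ⟨p + p', E.add_mem_supClosure hp hp', q + q', E.add_mem_supClosure hq hq', by abel⟩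
  smul_mem' := by
    rintro c _ ⟨p, hp, q, hq, rfl⟩
    rcases le_total 0 c with hc | hc
    · exact ⟨c • p, E.smul_mem_supClosure hc hp, c • q, E.smul_mem_supClosure hc hq, smul_sub _ _ _⟩
    · refine ⟨(-c) • q, E.smul_mem_supClosure (neg_nonneg.2 hc) hq, (-c) • p,
        E.smul_mem_supClosure (neg_nonneg.2 hc) hp, ?_⟩
      module

theorem Submodule.le_latticeSpan (E : Submodule ℝ V) : E ≤ E.latticeSpan := fun a ha =>
  ⟨a, subset_supClosure ha, 0, subset_supClosure E.zero_mem, by simp⟩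

theorem Submodule.sup_mem_latticeSpan (E : Submodule ℝ V) {u v : V} (hu : u ∈ E.latticeSpan)
    (hv : v ∈ E.latticeSpan) : u ⊔ v ∈ E.latticeSpan := by
  obtain ⟨p, hp, q, hq, rfl⟩ := hu
  obtain ⟨p', hp', q', hq', rfl⟩ := hv
  -- Both differences are rewritten with the common subtrahend `q + q'`; translations commute with
  -- suprema.
  refine ⟨(p + q') ⊔ (p' + q), supClosed_supClosure (E.add_mem_supClosure hp hq')
    (E.add_mem_supClosure hp' hq), q + q', E.add_mem_supClosure hq hq', ?_⟩
  rw [sub_eq_add_neg ((p + q') ⊔ (p' + q)), sup_add]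
  congr 1 <;> abel

end VectorLattice

/-! ### Linear functionals on the sphere: density and convex hulls -/

section Homogeneous

variable {n : ℕ}

/-- The unit sphere of the maximum norm on `ℝⁿ`. -/
abbrev maxSphere (n : ℕ) : Set (Fin n → ℝ) := Metric.sphere 0 1

/-- The linear functional `t ↦ ∑ i, a i * t i`, restricted to the unit sphere. -/
noncomputable def sphereFunctional (n : ℕ) : (Fin n → ℝ) →ₗ[ℝ] C(maxSphere n, ℝ) where
  toFun a := ⟨fun t => a ⬝ᵥ (t : Fin n → ℝ), continuous_const.dotProduct continuous_subtype_val⟩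
  map_add' a b := by ext t; simp
  map_smul' c a := by ext t; simp

@[simp]
theorem sphereFunctional_apply (a : Fin n → ℝ) (t : maxSphere n) :
    sphereFunctional n a t = a ⬝ᵥ (t : Fin n → ℝ) := rfl

/-- Non-antipodal points of the sphere are equal or linearly independent. -/
theorem exists_dotProduct_eq_dotProduct_eq (v : maxSphere n → ℝ) (s t : maxSphere n)
    (h : (s : Fin n → ℝ) ≠ -t) :
    ∃ a : Fin n → ℝ, a ⬝ᵥ (s : Fin n → ℝ) = v s ∧ a ⬝ᵥ (t : Fin n → ℝ) = v t := by
  by_cases hst : s = t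
  · subst hst
    have hs : (s : Fin n → ℝ) ⬝ᵥ (s : Fin n → ℝ) ≠ 0 := by
      rw [Ne, dotProduct_self_eq_zero]
      exact ne_zero_of_mem_unit_sphere s
    exact ⟨(v s / ((s : Fin n → ℝ) ⬝ᵥ (s : Fin n → ℝ))) • (s : Fin n → ℝ), by simp [hs]⟩
  · have hs : ‖(s : Fin n → ℝ)‖ = 1 := by simp
    have ht : ‖(t : Fin n → ℝ)‖ = 1 := by simp
    have hli : LinearIndependent ℝ ![(s : Fin n → ℝ), (t : Fin n → ℝ)] := by
      rw [LinearIndependent.pair_iff' (ne_zero_of_mem_unit_sphere s)]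
      intro c hc
      have hc1 : |c| = 1 := by
        have := congrArg norm hc
        simpa [norm_smul, hs, ht] using this
      rcases eq_or_eq_neg_of_abs_eq hc1 with rfl | rfl
      · exact hst (Subtype.ext (by simpa using hc))
      · exact h (by rw [← hc]; simp)
    obtain ⟨f, hf⟩ := LinearMap.exists_extend
      ((Module.Basis.span hli).constr ℝ ![v s, v t])
    have hfi : ∀ i, f (![(s : Fin n → ℝ), (t : Fin n → ℝ)] i) = ![v s, v t] i := fun i => by
      rw [← Module.Basis.constr_basis (Module.Basis.span hli) ℝ ![v s, v t] i, ← hf]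
      simp [Module.Basis.span_apply]
    obtain ⟨a, rfl⟩ := (dotProductEquiv ℝ (Fin n)).surjective f
    exact ⟨a, by simpa using hfi 0, by simpa using hfi 1⟩

/-- The lattice form of Stone–Weierstrass asks for interpolation at two points. Linear functionals
provide it except at antipodal pairs, where positive and negative parts are needed. -/
theorem dense_of_supClosed {L : Submodule ℝ C(maxSphere n, ℝ)}
    (hL : SupClosed (L : Set C(maxSphere n, ℝ))) (hle : LinearMap.range (sphereFunctional n) ≤ L) :
    Dense (L : Set C(maxSphere n, ℝ)) := by
  rw [dense_iff_closure_eq]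
  refine ContinuousMap.sublattice_closure_eq_top _ ⟨0, L.zero_mem⟩
    (fun f hf g hg => Submodule.inf_mem_of_sup_mem hL hf hg) (fun f hf g hg => hL hf hg) ?_
  intro v s t
  by_cases h : (s : Fin n → ℝ) = -t
  · have hs : (s : Fin n → ℝ) ⬝ᵥ (s : Fin n → ℝ) ≠ 0 := by
      rw [Ne, dotProduct_self_eq_zero]
      exact ne_zero_of_mem_unit_sphere s
    have hpos : 0 < (s : Fin n → ℝ) ⬝ᵥ (s : Fin n → ℝ) :=
      lt_of_le_of_ne (Finset.sum_nonneg fun i _ => mul_self_nonneg _) hs.symm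
    have ht : (t : Fin n → ℝ) = -s := by simp [h]
    set f := sphereFunctional n s with hf
    have hfL : f ∈ L := hle ⟨_, rfl⟩
    -- `f ⊔ 0` vanishes at `t = -s` and `(-f) ⊔ 0` vanishes at `s`, so the two values are adjusted
    -- independently.
    refine ⟨(v s / ((s : Fin n → ℝ) ⬝ᵥ (s : Fin n → ℝ))) • (f ⊔ 0) +
      (v t / ((s : Fin n → ℝ) ⬝ᵥ (s : Fin n → ℝ))) • ((-f) ⊔ 0),
      L.add_mem (L.smul_mem _ (hL hfL L.zero_mem)) (L.smul_mem _ (hL (L.neg_mem hfL) L.zero_mem)),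
      ?_, ?_⟩
    · simp [hf, hpos.le, hs]
    · simp [hf, ht, hpos.le, hs]
  · obtain ⟨a, ha⟩ := exists_dotProduct_eq_dotProduct_eq v s t h
    exact ⟨sphereFunctional n a, hle ⟨a, rfl⟩, by simpa using ha⟩

/-- Otherwise a functional strictly separates `a` from the compact hull; it is the dot product with
some `t ≠ 0`, and normalizing `t` contradicts `h`. -/
theorem mem_convexHull_of_le_sup {a : Fin n → ℝ} {B : Finset (Fin n → ℝ)} (hB : B.Nonempty)
    (h : ∀ t : maxSphere n, ∃ b ∈ B, a ⬝ᵥ (t : Fin n → ℝ) ≤ b ⬝ᵥ (t : Fin n → ℝ)) :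
    a ∈ convexHull ℝ (B : Set (Fin n → ℝ)) := by
  by_contra ha
  obtain ⟨f, u, hf, hu⟩ := geometric_hahn_banach_closed_point (convex_convexHull ℝ _)
    (B.finite_toSet.isCompact_convexHull ℝ).isClosed ha
  obtain ⟨t, ht⟩ := (dotProductEquiv ℝ (Fin n)).surjective f.toLinearMap
  have hft : ∀ x, f x = x ⬝ᵥ t := fun x => by
    rw [dotProduct_comm]
    exact (LinearMap.congr_fun ht x).symm
  have hlt : ∀ b ∈ B, b ⬝ᵥ t < a ⬝ᵥ t := fun b hb => by
    rw [← hft, ← hft]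
    exact (hf b (subset_convexHull ℝ _ hb)).trans hu
  have ht0 : t ≠ 0 := by
    rintro rfl
    obtain ⟨b, hb⟩ := hB
    simpa using hlt b hb
  obtain ⟨b, hb, hab⟩ := h ⟨‖t‖⁻¹ • t, by simp [norm_smul, ht0]⟩
  simp only [dotProduct_smul, smul_eq_mul] at hab
  exact (hlt b hb).not_ge (le_of_mul_le_mul_left hab (by positivity))

end Homogeneous

theorem norm_le_norm_of_nonneg_of_le {X : Type*} [NormedAddCommGroup X]
    [Lattice X] [HasSolidNorm X] [IsOrderedAddMonoid X] {a b : X} (ha : 0 ≤ a) (hab : a ≤ b) : ‖a‖ ≤ ‖b‖ :=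
  HasSolidNorm.solid (by rwa [abs_of_nonneg ha, abs_of_nonneg (ha.trans hab)])

/-! ### Existence of the functional calculus -/

section KrivineCalculus

variable {X : Type*} [NormedAddCommGroup X] [NormedSpace ℝ X] {n : ℕ}

/-- The linear functional with coefficients `a`, restricted to the unit sphere, together with its
value at `x ∈ Xⁿ`. -/
noncomputable def jointEval (x : Fin n → X) : (Fin n → ℝ) →ₗ[ℝ] C(maxSphere n, ℝ) × X :=
  (sphereFunctional n).prod (Fintype.linearCombination ℝ x)

theorem jointEval_apply (x : Fin n → X) (a : Fin n → ℝ) :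
    jointEval x a = (sphereFunctional n a, ∑ i, a i • x i) := rfl

theorem jointEval_single (x : Fin n → X) (i : Fin n) :
    jointEval x (Pi.single i 1) = (sphereFunctional n (Pi.single i 1), x i) := by
  rw [jointEval_apply]
  congr 1
  simp [Pi.single_apply, ite_smul]

variable [Lattice X] [IsOrderedAddMonoid X]

theorem Submodule.sum_mem_supClosure {V ι : Type*} [AddCommGroup V] [Module ℝ V] [Lattice V]
    [IsOrderedAddMonoid V] (E : Submodule ℝ V) (s : Finset ι) {v : ι → V}
    (h : ∀ i ∈ s, v i ∈ supClosure (E : Set V)) : ∑ i ∈ s, v i ∈ supClosure (E : Set V) := by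
  refine Finset.sum_induction v (· ∈ supClosure (E : Set V))
    (fun a b ha hb => E.add_mem_supClosure ha hb) (subset_supClosure E.zero_mem) h

/-- Since `∑ i, |t i| ≥ 1` on the sphere, this pair serves as an order unit in the bounds below. -/
theorem sum_abs_mem_supClosure (x : Fin n → X) :
    (∑ i, |sphereFunctional n (Pi.single i 1)|, ∑ i, |x i|) ∈
      supClosure (LinearMap.range (jointEval x) : Set (C(maxSphere n, ℝ) × X)) := by
  have h : (∑ i, |sphereFunctional n (Pi.single i 1)|, ∑ i, |x i|) =
      ∑ i, |jointEval x (Pi.single i 1)| := by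
    simp only [jointEval_single]
    rw [prod_mk_sum]
    rfl
  rw [h]
  exact Submodule.sum_mem_supClosure _ _ fun i _ => supClosed_supClosure
    (subset_supClosure (LinearMap.mem_range_self _ _))
    (subset_supClosure (Submodule.neg_mem _ (LinearMap.mem_range_self _ _)))

variable [IsOrderedModule ℝ X]

/-- The crux: order between functions on the sphere forces order in `X`. The admissible `p` are
closed under suprema, so `p` may be taken linear; it is then a convex combination of the functionals
whose supremum is `q`. -/
theorem snd_le_snd_of_mem_supClosure {x : Fin n → X} {p q : C(maxSphere n, ℝ) × X}
    (hp : p ∈ supClosure (LinearMap.range (jointEval x) : Set (C(maxSphere n, ℝ) × X)))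
    (hq : q ∈ supClosure (LinearMap.range (jointEval x) : Set (C(maxSphere n, ℝ) × X)))
    (h : p.1 ≤ q.1) : p.2 ≤ q.2 := by
  classical
  refine supClosure_min (t := {p | p.1 ≤ q.1 → p.2 ≤ q.2}) ?_ ?_ hp h
  · rintro _ ⟨a, rfl⟩ ha
    obtain ⟨s, hs, hsr, rfl⟩ := hq
    rw [LinearMap.coe_range, ← Set.image_univ, Finset.subset_set_image_iff] at hsr
    obtain ⟨B, -, rfl⟩ := hsr
    have hB : B.Nonempty := Finset.image_nonempty.1 hs
    have hmem : a ∈ convexHull ℝ (B : Set (Fin n → ℝ)) := by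
      refine mem_convexHull_of_le_sup hB fun t => ?_
      by_contra! hlt
      have hsup : (((B.image (jointEval x)).sup' hs id).1 : C(maxSphere n, ℝ)) t <
          a ⬝ᵥ (t : Fin n → ℝ) := by
        refine Finset.sup'_induction hs id
          (p := fun v : C(maxSphere n, ℝ) × X => v.1 t < a ⬝ᵥ (t : Fin n → ℝ)) ?_ ?_
        · intro u hu v hv
          exact max_lt hu hv
        · intro v hv
          obtain ⟨b, hb, rfl⟩ := Finset.mem_image.1 hv
          exact hlt b hb
      exact hsup.not_ge (ha t)
    -- The coefficients whose value at `x` lies below `q.2` form a convex set containing `B`, hence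
    -- `a`.
    refine convexHull_min (t := {b | (jointEval x b).2 ≤ ((B.image (jointEval x)).sup' hs id).2})
      (fun b hb => ?_) ?_ hmem
    · exact (Finset.le_sup' id (Finset.mem_image_of_mem (jointEval x) hb)).2
    · exact (convex_Iic _).linear_preimage ((LinearMap.snd ℝ _ _).comp (jointEval x))
  · intro u hu v hv huv
    exact sup_le (hu (le_sup_left.trans huv)) (hv (le_sup_right.trans huv))

theorem one_le_sum_abs (t : maxSphere n) : 1 ≤ ∑ i, |(t : Fin n → ℝ) i| := by
  have h : ‖(t : Fin n → ℝ)‖ ≤ ∑ i, |(t : Fin n → ℝ) i| :=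
    (pi_norm_le_iff_of_nonneg (by positivity)).2 fun i =>
      Finset.single_le_sum (f := fun i => |(t : Fin n → ℝ) i|) (fun _ _ => abs_nonneg _)
        (Finset.mem_univ i)
  simpa using h

theorem snd_le_of_mem_latticeSpan {x : Fin n → X} {g : C(maxSphere n, ℝ) × X}
    (hg : g ∈ (LinearMap.range (jointEval x)).latticeSpan) {c : ℝ} (hc : ∀ t, g.1 t ≤ c)
    (hc0 : 0 ≤ c) : g.2 ≤ c • ∑ i, |x i| := by
  obtain ⟨p, hp, q, hq, rfl⟩ := hg
  have := snd_le_snd_of_mem_supClosure hp (Submodule.add_mem_supClosure _ hq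
    (Submodule.smul_mem_supClosure _ hc0 (sum_abs_mem_supClosure x))) fun t => ?_
  · exact sub_le_iff_le_add'.2 this
  · have h1 := hc t
    have h2 : c ≤ c * ∑ i, |(t : Fin n → ℝ) i| := le_mul_of_one_le_right hc0 (one_le_sum_abs t)
    simp at h1 ⊢
    linarith

variable [HasSolidNorm X]

/-- The one-sided estimate applied to `g` and `-g`. In particular the first component determines the
second. -/
theorem norm_snd_le_of_mem_latticeSpan {x : Fin n → X} {g : C(maxSphere n, ℝ) × X}
    (hg : g ∈ (LinearMap.range (jointEval x)).latticeSpan) :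
    ‖g.2‖ ≤ ‖∑ i, |x i|‖ * ‖g.1‖ := by
  have h1 := snd_le_of_mem_latticeSpan hg (c := ‖g.1‖)
    (fun t => (le_abs_self _).trans (g.1.norm_coe_le_norm t)) (norm_nonneg _)
  have h2 := snd_le_of_mem_latticeSpan (Submodule.neg_mem _ hg) (c := ‖g.1‖)
    (fun t => (neg_le_abs _).trans (g.1.norm_coe_le_norm t)) (norm_nonneg _)
  have h : |g.2| ≤ ‖g.1‖ • ∑ i, |x i| := abs_le'.2 ⟨h1, h2⟩
  have := HasSolidNorm.solid (h.trans (le_abs_self _))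
  rwa [norm_smul, norm_norm, mul_comm] at this

/-- The restriction of a positively homogeneous function to the unit sphere. -/
noncomputable def HomogFun.restrictSphere (n : ℕ) : HomogFun n →ₗ[ℝ] C(maxSphere n, ℝ) where
  toFun h := (h : C(Fin n → ℝ, ℝ)).restrict (maxSphere n)
  map_add' _ _ := rfl
  map_smul' _ _ := rfl

@[simp]
theorem HomogFun.restrictSphere_apply (h : HomogFun n) (t : maxSphere n) :
    HomogFun.restrictSphere n h t = (h : C(Fin n → ℝ, ℝ)) t := rfl

theorem HomogFun.restrictSphere_max (h₁ h₂ : HomogFun n) :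
    HomogFun.restrictSphere n (HomogFun.max h₁ h₂) =
      HomogFun.restrictSphere n h₁ ⊔ HomogFun.restrictSphere n h₂ := rfl

theorem HomogFun.restrictSphere_proj (i : Fin n) :
    HomogFun.restrictSphere n (HomogFun.proj i) = sphereFunctional n (Pi.single i 1) := by
  ext t
  simp [HomogFun.proj]

theorem ContinuousMap.hasSolidNorm (K : Type*) [TopologicalSpace K] [CompactSpace K] :
    HasSolidNorm C(K, ℝ) where
  solid _ g h := (ContinuousMap.norm_le _ (norm_nonneg g)).2 fun t =>
    (h t : |_| ≤ |_|).trans (g.norm_coe_le_norm t)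

theorem exists_isKrivineCalculus [CompleteSpace X] (x : Fin n → X) :
    ∃ τ : HomogFun n →ₗ[ℝ] X, IsKrivineCalculus x τ := by
  set G := (LinearMap.range (jointEval x)).latticeSpan with hG
  have hmem : ∀ a, jointEval x a ∈ G := fun a => Submodule.le_latticeSpan _ ⟨a, rfl⟩
  set e : G →ₗ[ℝ] C(maxSphere n, ℝ) := (LinearMap.fst ℝ _ _).comp G.subtype with he
  set f : G →ₗ[ℝ] X := (LinearMap.snd ℝ _ _).comp G.subtype with hf
  have hdense : DenseRange e := by
    have : Dense (LinearMap.range e : Set C(maxSphere n, ℝ)) := by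
      apply dense_of_supClosed
      · rintro _ ⟨u, rfl⟩ _ ⟨v, rfl⟩
        exact ⟨⟨u.1 ⊔ v.1, Submodule.sup_mem_latticeSpan _ u.2 v.2⟩, rfl⟩
      · rintro _ ⟨a, rfl⟩
        exact ⟨⟨_, hmem a⟩, rfl⟩
    rwa [LinearMap.coe_range] at this
  have hbound : ∃ C, ∀ g : G, ‖f g‖ ≤ C * ‖e g‖ :=
    ⟨_, fun g => norm_snd_le_of_mem_latticeSpan g.2⟩
  -- The bound makes `f` factor through the dense range of `e`.
  set Φ := f.extendOfNorm e with hΦ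
  have hΦe : ∀ g : G, Φ (e g) = f g := LinearMap.extendOfNorm_eq hdense hbound
  -- Solidity makes `⊔` continuous, so the lattice identity passes from the dense range to the whole
  -- space.
  have := ContinuousMap.hasSolidNorm (maxSphere n)
  have hsup : ∀ u v, Φ (u ⊔ v) = Φ u ⊔ Φ v := fun u v =>
    hdense.induction_on₂ (isClosed_eq (Φ.continuous.comp (continuous_fst.sup continuous_snd))
      ((Φ.continuous.comp continuous_fst).sup (Φ.continuous.comp continuous_snd))) (fun u v => by
      have : e u ⊔ e v = e ⟨u.1 ⊔ v.1, Submodule.sup_mem_latticeSpan _ u.2 v.2⟩ := rfl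
      rw [this, hΦe, hΦe, hΦe]
      rfl) u v
  refine ⟨Φ.toLinearMap.comp (HomogFun.restrictSphere n), fun i => ?_, fun h₁ h₂ => ?_⟩
  · have : HomogFun.restrictSphere n (HomogFun.proj i) = e ⟨_, hmem (Pi.single i 1)⟩ := by
      rw [HomogFun.restrictSphere_proj]
      rfl
    simp [this, hΦe, hf, jointEval_single]
  · simp [HomogFun.restrictSphere_max, hsup]

end KrivineCalculus

/-! ### Automatic boundedness and uniqueness of the calculus -/

namespace HomogFun

variable {n : ℕ}

theorem apply_zero (h : HomogFun n) : (h : C(Fin n → ℝ, ℝ)) 0 = 0 := by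
  simpa using h.2 0 le_rfl 0

theorem le_of_restrictSphere_le {h₁ h₂ : HomogFun n}
    (h : restrictSphere n h₁ ≤ restrictSphere n h₂) (t : Fin n → ℝ) :
    (h₁ : C(Fin n → ℝ, ℝ)) t ≤ (h₂ : C(Fin n → ℝ, ℝ)) t := by
  rcases eq_or_ne t 0 with rfl | ht
  · rw [apply_zero, apply_zero]
  · have hs := h ⟨‖t‖⁻¹ • t, by simp [norm_smul, ht]⟩
    have hn : 0 ≤ ‖t‖⁻¹ := by positivity
    change (h₁ : C(Fin n → ℝ, ℝ)) (‖t‖⁻¹ • t) ≤ (h₂ : C(Fin n → ℝ, ℝ)) (‖t‖⁻¹ • t) at hs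
    rw [h₁.2 _ hn, h₂.2 _ hn] at hs
    exact le_of_mul_le_mul_left hs (by positivity)

/-- The function `t ↦ |t i|`. -/
def absProj (i : Fin n) : HomogFun n := HomogFun.max (proj i) (-proj i)

@[simp]
theorem absProj_apply (i : Fin n) (t : Fin n → ℝ) :
    (absProj i : C(Fin n → ℝ, ℝ)) t = |t i| := rfl

@[simp]
theorem proj_apply (i : Fin n) (t : Fin n → ℝ) : (proj i : C(Fin n → ℝ, ℝ)) t = t i := rfl

end HomogFun

namespace IsKrivineCalculus

variable {X : Type*} [NormedAddCommGroup X] [NormedSpace ℝ X] [Lattice X] {n : ℕ}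
  {x : Fin n → X} {τ τ' : HomogFun n →ₗ[ℝ] X}

theorem monotone (hτ : IsKrivineCalculus x τ) {h₁ h₂ : HomogFun n}
    (h : ∀ t, (h₁ : C(Fin n → ℝ, ℝ)) t ≤ (h₂ : C(Fin n → ℝ, ℝ)) t) : τ h₁ ≤ τ h₂ := by
  have : HomogFun.max h₁ h₂ = h₂ := by
    ext t
    exact max_eq_right (h t)
  rw [← this, hτ.map_max]
  exact le_sup_left

theorem map_absProj (hτ : IsKrivineCalculus x τ) (i : Fin n) : τ (HomogFun.absProj i) = |x i| := by
  rw [HomogFun.absProj, hτ.map_max, map_neg, hτ.map_proj]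
  rfl

theorem le_norm_smul (hτ : IsKrivineCalculus x τ) (h : HomogFun n) :
    τ h ≤ ‖HomogFun.restrictSphere n h‖ • ∑ i, |x i| := by
  have : τ h ≤ τ (‖HomogFun.restrictSphere n h‖ • ∑ i, HomogFun.absProj i) := by
    refine hτ.monotone (HomogFun.le_of_restrictSphere_le fun t => ?_)
    have h1 := (le_abs_self _).trans ((HomogFun.restrictSphere n h).norm_coe_le_norm t)
    have h2 := le_mul_of_one_le_right (norm_nonneg (HomogFun.restrictSphere n h))
      (one_le_sum_abs t)
    simpa using h1.trans h2
  simpa [map_sum, hτ.map_absProj] using this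

variable [HasSolidNorm X]

theorem norm_apply_le (hτ : IsKrivineCalculus x τ) (h : HomogFun n) :
    ‖τ h‖ ≤ ‖∑ i, |x i|‖ * ‖HomogFun.restrictSphere n h‖ := by
  have h1 := hτ.le_norm_smul h
  have h2 := hτ.le_norm_smul (-h)
  rw [map_neg, map_neg, norm_neg] at h2
  have := HasSolidNorm.solid ((abs_le'.2 ⟨h1, h2⟩).trans (le_abs_self _))
  rwa [norm_smul, norm_norm, mul_comm] at this

/-- Two calculi agree on a sublattice containing the projections, which is dense on the sphere;
`norm_apply_le` carries the agreement to limits. -/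
theorem unique [IsOrderedAddMonoid X] (hτ : IsKrivineCalculus x τ) (hτ' : IsKrivineCalculus x τ') : τ = τ' := by
  have hdense : Dense ((LinearMap.eqLocus τ τ').map (HomogFun.restrictSphere n) :
      Set C(maxSphere n, ℝ)) := by
    apply dense_of_supClosed
    · rintro _ ⟨u, hu, rfl⟩ _ ⟨v, hv, rfl⟩
      refine ⟨HomogFun.max u v, ?_, HomogFun.restrictSphere_max u v⟩
      have hu' : τ u = τ' u := hu
      have hv' : τ v = τ' v := hv
      change τ _ = τ' _
      rw [hτ.map_max, hτ'.map_max, hu', hv']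
    · rintro _ ⟨a, rfl⟩
      refine ⟨∑ i, a i • HomogFun.proj i, ?_, ?_⟩
      · change τ _ = τ' _
        simp [hτ.map_proj, hτ'.map_proj]
      · ext t
        simp [dotProduct]
  ext1 h
  obtain ⟨u, hu, hlim⟩ := mem_closure_iff_seq_limit.1 (hdense (HomogFun.restrictSphere n h))
  have hlim' := ((hlim.const_sub (HomogFun.restrictSphere n h)).norm.const_mul
    (2 * ‖∑ i, |x i|‖))
  rw [sub_self, norm_zero, mul_zero] at hlim'
  refine sub_eq_zero.1 (norm_le_zero_iff.1 (ge_of_tendsto' hlim' fun k => ?_))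
  obtain ⟨g, hg, hgk⟩ := hu k
  have hg' : τ g = τ' g := hg
  have h1 := hτ.norm_apply_le (h - g)
  have h2 := hτ'.norm_apply_le (h - g)
  have h3 : τ h - τ' h = τ (h - g) - τ' (h - g) := by
    rw [map_sub, map_sub, hg']
    abel
  rw [map_sub (HomogFun.restrictSphere n), hgk] at h1 h2
  rw [h3]
  linarith [norm_sub_le (τ (h - g)) (τ' (h - g))]

end IsKrivineCalculus

/-! ### Change of variables and the seminorm `tauNorm` -/

namespace HomogFun

variable {m n : ℕ}

/-- Composition of a positively homogeneous function with a linear map. -/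
noncomputable def compLinear (A : (Fin m → ℝ) →ₗ[ℝ] (Fin n → ℝ)) :
    HomogFun n →ₗ[ℝ] HomogFun m where
  toFun h := ⟨(h : C(Fin n → ℝ, ℝ)).comp ⟨A, A.continuous_of_finiteDimensional⟩, fun c hc t => by
    simp [h.2 c hc]⟩
  map_add' _ _ := rfl
  map_smul' _ _ := rfl

@[simp]
theorem compLinear_apply (A : (Fin m → ℝ) →ₗ[ℝ] (Fin n → ℝ)) (h : HomogFun n) (t : Fin m → ℝ) :
    (compLinear A h : C(Fin m → ℝ, ℝ)) t = (h : C(Fin n → ℝ, ℝ)) (A t) := rfl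

@[simp]
theorem ofNorm_apply (Y : BanachSequenceLattice) (t : Fin n → ℝ) :
    (ofNorm Y n : C(Fin n → ℝ, ℝ)) t = Y.finNorm n t := rfl

end HomogFun

section Krivine

variable {X : Type*} [NormedAddCommGroup X] [NormedSpace ℝ X] [Lattice X]

theorem tauNorm_nonneg (Y : BanachSequenceLattice) {n : ℕ} (x : Fin n → X) : 0 ≤ tauNorm Y x :=
  norm_nonneg _

theorem IsKrivineCalculus.compLinear {m n : ℕ} {z : Fin m → X} {τ : HomogFun m →ₗ[ℝ] X}
    (hτ : IsKrivineCalculus z τ) (A : (Fin m → ℝ) →ₗ[ℝ] (Fin n → ℝ)) :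
    IsKrivineCalculus (fun i => τ (HomogFun.compLinear A (HomogFun.proj i)))
      (τ.comp (HomogFun.compLinear A)) where
  map_proj _ := rfl
  map_max h₁ h₂ := hτ.map_max (HomogFun.compLinear A h₁) (HomogFun.compLinear A h₂)

variable [HasSolidNorm X] [IsOrderedAddMonoid X] [IsOrderedModule ℝ X] [CompleteSpace X]

theorem isKrivineCalculus_krivine {n : ℕ} (x : Fin n → X) : IsKrivineCalculus x (krivine x) := by
  have h := exists_isKrivineCalculus x
  rw [krivine, dif_pos h]
  exact h.choose_spec

/-- By uniqueness, calculi at several linear images of one tuple `z` can all be computed in the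
calculus at `z`. -/
theorem krivine_compLinear {m n : ℕ} (A : (Fin m → ℝ) →ₗ[ℝ] (Fin n → ℝ)) {z : Fin m → X}
    {x : Fin n → X} (hx : ∀ i, krivine z (HomogFun.compLinear A (HomogFun.proj i)) = x i)
    (h : HomogFun n) : krivine x h = krivine z (HomogFun.compLinear A h) := by
  obtain rfl : (fun i => krivine z (HomogFun.compLinear A (HomogFun.proj i))) = x := funext hx
  exact LinearMap.congr_fun ((isKrivineCalculus_krivine _).unique
    ((isKrivineCalculus_krivine z).compLinear A)) h

variable (Y : BanachSequenceLattice) {n : ℕ}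

theorem krivine_ofNorm_nonneg (x : Fin n → X) : 0 ≤ krivine x (HomogFun.ofNorm Y n) := by
  rw [← map_zero (krivine x)]
  exact (isKrivineCalculus_krivine x).monotone fun t => apply_nonneg (Y.finNorm n) t

/-- The tuples `x`, `y` and `x + y` are linear images of their concatenation, so the claim reduces
to the pointwise triangle inequality. -/
theorem krivine_add_le (x y : Fin n → X) :
    krivine (x + y) (HomogFun.ofNorm Y n) ≤
      krivine x (HomogFun.ofNorm Y n) + krivine y (HomogFun.ofNorm Y n) := by
  set z : Fin (n + n) → X := Fin.append x y with hz
  set P : (Fin (n + n) → ℝ) →ₗ[ℝ] (Fin n → ℝ) := LinearMap.funLeft ℝ ℝ (Fin.castAdd n) with hP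
  set Q : (Fin (n + n) → ℝ) →ₗ[ℝ] (Fin n → ℝ) := LinearMap.funLeft ℝ ℝ (Fin.natAdd n) with hQ
  have hz' := isKrivineCalculus_krivine z
  have hPp : ∀ i : Fin n, HomogFun.compLinear P (HomogFun.proj i) =
      HomogFun.proj (Fin.castAdd n i) := fun i => rfl
  have hQp : ∀ i : Fin n, HomogFun.compLinear Q (HomogFun.proj i) =
      HomogFun.proj (Fin.natAdd n i) := fun i => rfl
  have hPQp : ∀ i : Fin n, HomogFun.compLinear (P + Q) (HomogFun.proj i) =
      HomogFun.proj (Fin.castAdd n i) + HomogFun.proj (Fin.natAdd n i) := fun i => rfl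
  have hx := krivine_compLinear P (z := z) (x := x)
    (fun i => by rw [hPp, hz'.map_proj, hz, Fin.append_left])
  have hy := krivine_compLinear Q (z := z) (x := y)
    (fun i => by rw [hQp, hz'.map_proj, hz, Fin.append_right])
  have hxy := krivine_compLinear (P + Q) (z := z) (x := x + y)
    (fun i => by rw [hPQp, map_add, hz'.map_proj, hz'.map_proj, hz, Fin.append_left,
      Fin.append_right, Pi.add_apply])
  rw [hx, hy, hxy, ← map_add]
  exact hz'.monotone fun t => map_add_le_add (Y.finNorm n) _ _

theorem tauNorm_add_le (x y : Fin n → X) : tauNorm Y (x + y) ≤ tauNorm Y x + tauNorm Y y :=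
  (norm_le_norm_of_nonneg_of_le (krivine_ofNorm_nonneg Y _) (krivine_add_le Y x y)).trans
    (norm_add_le _ _)

theorem tauNorm_smul (c : ℝ) (x : Fin n → X) : tauNorm Y (c • x) = |c| * tauNorm Y x := by
  have h := krivine_compLinear (c • LinearMap.id) (z := x) (x := c • x) (fun i => by
    have : HomogFun.compLinear (c • LinearMap.id) (HomogFun.proj i) = c • HomogFun.proj i := rfl
    rw [this, map_smul, (isKrivineCalculus_krivine x).map_proj, Pi.smul_apply])
    (HomogFun.ofNorm Y n)
  have h' : HomogFun.compLinear (c • LinearMap.id) (HomogFun.ofNorm Y n) =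
      |c| • HomogFun.ofNorm Y n := by
    ext t
    simp [map_smul_eq_mul]
  rw [tauNorm, h, h', map_smul, norm_smul, Real.norm_eq_abs, abs_abs, tauNorm]

/-- `‖·‖_{Xⁿ,Y,τ}` as a seminorm. -/
noncomputable def tauSeminorm (n : ℕ) : Seminorm ℝ (Fin n → X) :=
  Seminorm.of (tauNorm Y) (tauNorm_add_le Y) (tauNorm_smul Y)

/-- Pointwise `‖t‖ ≤ ∑ i, |t i| ‖e_i‖` in `Y`. This makes the seminorm continuous at zero, hence
everywhere. -/
theorem tauNorm_le_sum (x : Fin n → X) :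
    tauNorm Y x ≤ ∑ i, Y.finNorm n (Pi.single i 1) * ‖x i‖ := by
  have hx := isKrivineCalculus_krivine x
  have h : krivine x (HomogFun.ofNorm Y n) ≤
      krivine x (∑ i, Y.finNorm n (Pi.single i 1) • HomogFun.absProj i) := by
    refine hx.monotone fun t => ?_
    have ht : t = ∑ i, t i • (Pi.single i 1 : Fin n → ℝ) := by
      ext j
      simp [Finset.sum_apply, Pi.single_apply]
    have hsum := Finset.univ.le_sum_of_subadditive (Y.finNorm n) (map_zero _).le (map_add_le_add _)
      fun i => t i • (Pi.single i 1 : Fin n → ℝ)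
    rw [← ht] at hsum
    simpa [map_smul_eq_mul, mul_comm] using hsum
  refine (norm_le_norm_of_nonneg_of_le (krivine_ofNorm_nonneg Y _) h).trans ?_
  rw [map_sum]
  refine norm_sum_le_of_le _ fun i _ => ?_
  rw [map_smul, hx.map_absProj, norm_smul, norm_abs_eq_norm, Real.norm_eq_abs,
    abs_of_nonneg (apply_nonneg _ _)]

theorem continuous_tauNorm : Continuous (tauNorm Y : (Fin n → X) → ℝ) := by
  suffices Continuous (tauSeminorm Y n : Seminorm ℝ (Fin n → X)) from this
  refine Seminorm.continuous_of_continuousAt_zero ?_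
  have h : Tendsto (fun x : Fin n → X => ∑ i, Y.finNorm n (Pi.single i 1) * ‖x i‖) (𝓝 0) (𝓝 0) := by
    refine Continuous.tendsto' (by fun_prop) 0 0 (by simp)
  rw [ContinuousAt, map_zero]
  exact squeeze_zero (tauNorm_nonneg Y) (tauNorm_le_sum Y) h

theorem tauNorm_fin_one (x : X) : tauNorm Y (fun _ : Fin 1 => x) = Y.finNorm 1 1 * ‖x‖ := by
  have hx := isKrivineCalculus_krivine (fun _ : Fin 1 => x)
  have h : HomogFun.ofNorm Y 1 = Y.finNorm 1 1 • HomogFun.absProj 0 := by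
    ext t
    have ht : t = t 0 • (1 : Fin 1 → ℝ) := by
      ext i
      simp [Subsingleton.elim i 0]
    conv_lhs => rw [ht]
    simp [map_smul_eq_mul, mul_comm]
  rw [tauNorm, h, map_smul, hx.map_absProj, norm_smul, norm_abs_eq_norm, Real.norm_eq_abs,
    abs_of_nonneg (apply_nonneg _ _)]

theorem BanachSequenceLattice.finNorm_one_pos : 0 < Y.finNorm 1 1 := by
  refine (apply_nonneg _ _).lt_of_ne' fun h => ?_
  have h0 := congrArg (fun f : Y.carrier => (f : ℕ → ℝ) ((0 : Fin 1) : ℕ))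
    (Y.eq_zero_of_nrm_eq_zero _ h)
  simp only [BanachSequenceLattice.incl, LinearMap.codRestrict_apply,
    Function.ExtendByZero.linearMap_apply, Fin.val_injective.extend_apply] at h0
  simp at h0

end Krivine

/-! ### The normed space of regular operators and its completeness -/

section Regular

variable {X W : Type*}
  [NormedAddCommGroup X] [NormedSpace ℝ X] [Lattice X]
  [NormedAddCommGroup W] [NormedSpace ℝ W] [Lattice W]
  {Y : BanachSequenceLattice} {S T : X →ₗ[ℝ] W} {C D : ℝ}

theorem yRegularNorm_nonneg (Y : BanachSequenceLattice) (T : X →ₗ[ℝ] W) :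
    0 ≤ yRegularNorm Y T := Real.sInf_nonneg fun _ h => h.1

theorem YRegularBound.yRegularNorm_le (h : YRegularBound Y T C) (hC : 0 ≤ C) :
    yRegularNorm Y T ≤ C := csInf_le ⟨0, fun _ h => h.1⟩ ⟨hC, h⟩

theorem YRegularBound.mono (h : YRegularBound Y T C) (hCD : C ≤ D) : YRegularBound Y T D :=
  fun n x => (h n x).trans (mul_le_mul_of_nonneg_right hCD (tauNorm_nonneg Y x))

/-- Each pair `(n, x)` imposes a closed condition on `C`, so the infimum is attained. -/
theorem IsYRegular.isLeast (h : IsYRegular Y T) :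
    IsLeast {C : ℝ | 0 ≤ C ∧ YRegularBound Y T C} (yRegularNorm Y T) := by
  obtain ⟨C, hC, hCT⟩ := h
  refine ⟨?_, fun D hD => hD.2.yRegularNorm_le hD.1⟩
  refine IsClosed.csInf_mem ?_ ⟨C, hC.le, hCT⟩ ⟨0, fun _ h => h.1⟩
  have hset : {C : ℝ | YRegularBound Y T C} = ⋂ (n : ℕ) (x : Fin n → X),
      {C : ℝ | tauNorm Y (fun i => T (x i)) ≤ C * tauNorm Y x} := by
    ext C
    simp [YRegularBound]
  have hclosed : IsClosed {C : ℝ | YRegularBound Y T C} := by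
    rw [hset]
    exact isClosed_iInter fun n => isClosed_iInter fun x =>
      isClosed_le continuous_const (continuous_id.mul continuous_const)
  exact isClosed_Ici.inter hclosed

theorem IsYRegular.yRegularBound (h : IsYRegular Y T) : YRegularBound Y T (yRegularNorm Y T) :=
  h.isLeast.1.2

theorem YRegularBound.isYRegular (h : YRegularBound Y T C) : IsYRegular Y T :=
  ⟨max C 1, lt_max_of_lt_right one_pos, h.mono (le_max_left _ _)⟩

variable [HasSolidNorm W] [IsOrderedAddMonoid W] [IsOrderedModule ℝ W] [CompleteSpace W]

theorem YRegularBound.add (hS : YRegularBound Y S C) (hT : YRegularBound Y T D) :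
    YRegularBound Y (S + T) (C + D) := fun n x => by
  rw [add_mul]
  exact (tauNorm_add_le Y (fun i => S (x i)) fun i => T (x i)).trans (add_le_add (hS n x) (hT n x))

theorem YRegularBound.smul (c : ℝ) (hT : YRegularBound Y T C) :
    YRegularBound Y (c • T) (|c| * C) := fun n x => by
  rw [mul_assoc]
  exact (tauNorm_smul Y c fun i => T (x i)).trans_le
    (mul_le_mul_of_nonneg_left (hT n x) (abs_nonneg c))

theorem yRegularBound_zero (Y : BanachSequenceLattice) :
    YRegularBound Y (0 : X →ₗ[ℝ] W) 0 := fun n x => by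
  rw [zero_mul]
  exact (map_zero (tauSeminorm Y n : Seminorm ℝ (Fin n → W))).le

/-- The space `Λ_Y(X, W)` of the `Y`-regular operators. -/
def yRegularSubmodule (X W : Type*)
    [NormedAddCommGroup X] [NormedSpace ℝ X] [Lattice X]
    [NormedAddCommGroup W] [NormedSpace ℝ W] [Lattice W]
    [HasSolidNorm W] [IsOrderedAddMonoid W] [IsOrderedModule ℝ W] [CompleteSpace W]
    (Y : BanachSequenceLattice) : Submodule ℝ (X →ₗ[ℝ] W) where
  carrier := {T | IsYRegular Y T}
  add_mem' hS hT := (hS.yRegularBound.add hT.yRegularBound).isYRegular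
  zero_mem' := (yRegularBound_zero Y).isYRegular
  smul_mem' c _ hT := (hT.yRegularBound.smul c).isYRegular

theorem IsYRegular.yRegularNorm_add_le (hS : IsYRegular Y S) (hT : IsYRegular Y T) :
    yRegularNorm Y (S + T) ≤ yRegularNorm Y S + yRegularNorm Y T :=
  (hS.yRegularBound.add hT.yRegularBound).yRegularNorm_le
    (add_nonneg (yRegularNorm_nonneg Y S) (yRegularNorm_nonneg Y T))

theorem IsYRegular.yRegularNorm_smul_le (c : ℝ) (hT : IsYRegular Y T) :
    yRegularNorm Y (c • T) ≤ |c| * yRegularNorm Y T :=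
  (hT.yRegularBound.smul c).yRegularNorm_le
    (mul_nonneg (abs_nonneg c) (yRegularNorm_nonneg Y T))

theorem yRegularNorm_zero (Y : BanachSequenceLattice) :
    yRegularNorm Y (0 : X →ₗ[ℝ] W) = 0 :=
  ((yRegularBound_zero Y).yRegularNorm_le le_rfl).antisymm (yRegularNorm_nonneg Y _)

theorem IsYRegular.yRegularNorm_smul (c : ℝ) (hT : IsYRegular Y T) :
    yRegularNorm Y (c • T) = |c| * yRegularNorm Y T := by
  rcases eq_or_ne c 0 with rfl | hc
  · simp [yRegularNorm_zero]
  refine (hT.yRegularNorm_smul_le c).antisymm ?_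
  have h := ((hT.yRegularBound.smul c).isYRegular).yRegularNorm_smul_le c⁻¹
  rw [smul_smul, inv_mul_cancel₀ hc, one_smul, abs_inv] at h
  have hc' : 0 < |c| := abs_pos.2 hc
  calc |c| * yRegularNorm Y T ≤ |c| * (|c|⁻¹ * yRegularNorm Y (c • T)) := by gcongr
    _ = yRegularNorm Y (c • T) := by field_simp

/-- Each instance of the bound involves finitely many vectors, so continuity of `tauNorm` on `Wⁿ`
lets it pass to pointwise limits. -/
theorem YRegularBound.of_tendsto {u : ℕ → X →ₗ[ℝ] W}
    (hu : ∀ x, Tendsto (fun k => u k x) atTop (𝓝 (T x)))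
    (h : ∀ᶠ k in atTop, YRegularBound Y (S - u k) C) :
    YRegularBound Y (S - T) C := fun n x => by
  have hlim : Tendsto (fun k => tauNorm Y fun i => (S - u k) (x i)) atTop
      (𝓝 (tauNorm Y fun i => (S - T) (x i))) :=
    ((continuous_tauNorm Y).tendsto _).comp
      (tendsto_pi_nhds.2 fun i => (hu (x i)).const_sub (S (x i)))
  exact le_of_tendsto hlim (h.mono fun k hk => hk n x)

variable [HasSolidNorm X] [IsOrderedAddMonoid X] [IsOrderedModule ℝ X] [CompleteSpace X]

/-- The case `n = 1`, where the positive factor `Y.finNorm 1 1` cancels. -/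
theorem YRegularBound.norm_apply_le (hT : YRegularBound Y T C) (x : X) : ‖T x‖ ≤ C * ‖x‖ := by
  have h := hT 1 fun _ => x
  rw [tauNorm_fin_one, tauNorm_fin_one, mul_left_comm] at h
  exact le_of_mul_le_mul_left h Y.finNorm_one_pos

theorem IsYRegular.eq_zero (hT : IsYRegular Y T) (h : yRegularNorm Y T = 0) : T = 0 := by
  ext x
  simpa [h] using hT.yRegularBound.norm_apply_le x

theorem exists_yRegularNorm_limit {u : ℕ → X →ₗ[ℝ] W} (hu : ∀ m, IsYRegular Y (u m))
    (hc : ∀ ε > 0, ∃ N, ∀ m ≥ N, ∀ k ≥ N, yRegularNorm Y (u m - u k) < ε) :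
    ∃ T, IsYRegular Y T ∧ ∀ ε > 0, ∃ N, ∀ m ≥ N, yRegularNorm Y (u m - T) < ε := by
  have hsub : ∀ m k, IsYRegular Y (u m - u k) := fun m k =>
    (yRegularSubmodule X W Y).sub_mem (hu m) (hu k)
  have hx : ∀ x, CauchySeq fun m => u m x := fun x => by
    refine Metric.cauchySeq_iff.2 fun ε hε => ?_
    -- The `+ 1` covers `x = 0`.
    obtain ⟨N, hN⟩ := hc (ε / (‖x‖ + 1)) (by positivity)
    refine ⟨N, fun m hm k hk => ?_⟩
    rw [dist_eq_norm]
    calc ‖u m x - u k x‖ ≤ yRegularNorm Y (u m - u k) * ‖x‖ :=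
          (hsub m k).yRegularBound.norm_apply_le x
      _ ≤ ε / (‖x‖ + 1) * ‖x‖ := mul_le_mul_of_nonneg_right (hN m hm k hk).le (norm_nonneg x)
      _ < ε / (‖x‖ + 1) * (‖x‖ + 1) := by gcongr; linarith
      _ = ε := by field_simp
  choose f hf using fun x => cauchySeq_tendsto_of_complete (hx x)
  set T : X →ₗ[ℝ] W := linearMapOfTendsto f u (tendsto_pi_nhds.2 hf) with hT
  have hb : ∀ ε > 0, ∃ N, ∀ m ≥ N, YRegularBound Y (u m - T) ε := fun ε hε => by
    obtain ⟨N, hN⟩ := hc ε hε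
    exact ⟨N, fun m hm => .of_tendsto hf ((eventually_ge_atTop N).mono fun k hk =>
      (hsub m k).yRegularBound.mono (hN m hm k hk).le)⟩
  refine ⟨T, ?_, fun ε hε => ?_⟩
  · obtain ⟨N, hN⟩ := hb 1 one_pos
    -- `T = u N - (u N - T)` is a difference of regular operators.
    have := (yRegularSubmodule X W Y).sub_mem (hu N) (hN N le_rfl).isYRegular
    rwa [sub_sub_cancel] at this
  · obtain ⟨N, hN⟩ := hb (ε / 2) (half_pos hε)
    exact ⟨N, fun m hm => ((hN m hm).yRegularNorm_le (half_pos hε).le).trans_lt (half_lt_self hε)⟩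

end Regular

/-- The `Y`-regular operators form a linear subspace `L` of the space of linear maps `X → W`; the
best constant in the defining inequality is attained and is a norm on `L`; with this norm `L` is
complete; and every `T ∈ L` is continuous, the inclusion of `L` into the bounded operators with the
operator norm being linear, continuous and of norm at most `1`. -/
theorem mainTheorem5 {X W : Type*}
    [NormedAddCommGroup X] [NormedSpace ℝ X] [Lattice X] [HasSolidNorm X] [IsOrderedAddMonoid X]
    [IsOrderedModule ℝ X] [CompleteSpace X]
    [NormedAddCommGroup W] [NormedSpace ℝ W] [Lattice W] [HasSolidNorm W] [IsOrderedAddMonoid W]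
    [IsOrderedModule ℝ W] [CompleteSpace W]
    (Y : BanachSequenceLattice) :
    ∃ L : Submodule ℝ (X →ₗ[ℝ] W),
      (∀ T : X →ₗ[ℝ] W, T ∈ L ↔ IsYRegular Y T) ∧
      (∀ T ∈ L, IsLeast {C : ℝ | 0 ≤ C ∧ YRegularBound Y T C} (yRegularNorm Y T)) ∧
      (letI : Norm L := ⟨fun T => yRegularNorm Y (T : X →ₗ[ℝ] W)⟩
       ∃ core : NormedSpace.Core ℝ L,
        letI : NormedAddCommGroup L := NormedAddCommGroup.ofCore core
        letI : NormedSpace ℝ L := NormedSpace.ofCore core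
        CompleteSpace L ∧
        ∃ ι : L →L[ℝ] (X →L[ℝ] W),
          (∀ (T : L) (x : X), ι T x = (T : X →ₗ[ℝ] W) x) ∧
          ∀ T : L, ‖ι T‖ ≤ yRegularNorm Y (T : X →ₗ[ℝ] W)) := by
  refine ⟨yRegularSubmodule X W Y, fun T => Iff.rfl, fun T hT => IsYRegular.isLeast hT, ?_⟩
  let : Norm (yRegularSubmodule X W Y) := ⟨fun T => yRegularNorm Y (T : X →ₗ[ℝ] W)⟩
  have core : NormedSpace.Core ℝ (yRegularSubmodule X W Y) :=
    { norm_nonneg := fun T => yRegularNorm_nonneg Y _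
      norm_smul := fun c T => IsYRegular.yRegularNorm_smul c T.2
      norm_triangle := fun S T => IsYRegular.yRegularNorm_add_le S.2 T.2
      norm_eq_zero_iff := fun T => ⟨fun h => Subtype.ext (IsYRegular.eq_zero T.2 h), fun h => by
        rw [h]
        exact yRegularNorm_zero Y⟩ }
  refine ⟨core, ?_⟩
  let : NormedAddCommGroup (yRegularSubmodule X W Y) := NormedAddCommGroup.ofCore core
  let : NormedSpace ℝ (yRegularSubmodule X W Y) := NormedSpace.ofCore core
  have hdist : ∀ S T : yRegularSubmodule X W Y, dist S T = yRegularNorm Y (S - T : X →ₗ[ℝ] W) :=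
    fun S T => dist_eq_norm S T
  refine ⟨Metric.complete_of_cauchySeq_tendsto fun u hu => ?_, ?_⟩
  · obtain ⟨T, hT, hlim⟩ := exists_yRegularNorm_limit (fun m => (u m).2) fun ε hε => by
      simpa only [hdist] using Metric.cauchySeq_iff.1 hu ε hε
    exact ⟨⟨T, hT⟩, Metric.tendsto_atTop.2 fun ε hε => by simpa only [hdist] using hlim ε hε⟩
  · have hb : ∀ (T : yRegularSubmodule X W Y) (x : X),
        ‖(T : X →ₗ[ℝ] W) x‖ ≤ yRegularNorm Y (T : X →ₗ[ℝ] W) * ‖x‖ := fun T =>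
      (IsYRegular.yRegularBound T.2).norm_apply_le
    have hle : ∀ T : yRegularSubmodule X W Y, ‖(T : X →ₗ[ℝ] W).mkContinuous _ (hb T)‖ ≤
        yRegularNorm Y (T : X →ₗ[ℝ] W) := fun T =>
      LinearMap.mkContinuous_norm_le _ (yRegularNorm_nonneg Y _) _
    refine ⟨LinearMap.mkContinuous
      { toFun := fun T => (T : X →ₗ[ℝ] W).mkContinuous _ (hb T)
        map_add' := fun _ _ => rfl
        map_smul' := fun _ _ => rfl } 1 fun T => ?_, fun _ _ => rfl, hle⟩
    rw [one_mul]
    exact hle T
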